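/- Fix $d\ge 0$. A (rational) \emph{polyhedron} in $\mathbb{R}^d$ is a set $\{x\in\mathbb{R}^d : Ax\ge b\}$ with $A$ an integral matrix and $b$ an integral vector; a \emph{half-open polyhedron} is a set defined in the same way, where any of the finitely many inequalities may be strict. A \emph{polytope} (\emph{half-open polytope}) is a bounded polyhedron (bounded half-open polyhedron), and a \emph{partial polytopal complex} is a subset of $\mathbb{R}^d$ that is a disjoint union of finitely many half-open polytopes. For $X\subset\mathbb{R}^d$ and an integer $k\ge 1$ let $\operatorname{ehr}_X(k)=\#(\mathbb{Z}^d\cap kX)$. A function $q:\mathbb{Z}\to\mathbb{Q}$ is a \emph{quasipolynomial with period} $\ell\ge 1$ if there are polynomials $p_0,\dots,p_{\ell-1}\in\mathbb{Q}[t]$ such that $q(k)=p_r(k)$ whenever $k\in\mathbb{Z}$, $0\le r<\ell$ and $k\equiv r \pmod \ell$; it is a \emph{quasipolynomial} if it is one with some period. \textbf{Theorem (Ehrhart).} (1) If $X\subset\mathbb{R}^d$ is a partial polytopal complex, then $\mathbb{Z}^d\cap kX$ is finite for every integer $k\ge1$, and there is a quasipolynomial $q$ with $\operatorname{ehr}_X(k)=q(k)$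 for all integers $k\ge 1$. (2) If $P\subset\mathbb{R}^d$ is a polytope, then $P$ has finitely many vertices (extreme points) $v_1,\dots,v_N$, all of them in $\mathbb{Q}^d$. If $\ell$ is the least common multiple of the denominators (in lowest terms) of all coordinates $v_{i,j}$, $1\le i\le N$, $1\le j\le d$ (with $\ell=1$ if there are none), then there is a quasipolynomial $q$ with period $\ell$ such that $\operatorname{ehr}_P(k)=q(k)$ for all integers $k\ge 1$. -/

import Mathlib

open scoped Pointwise

namespace EhrhartTheory

/-- `P = {x ∈ ℝ^d | A x ≥ b}` for an integral matrix `A` and an integral vector `b`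
(all polyhedra are rational). -/
def IsPolyhedron {d : ℕ} (P : Set (Fin d → ℝ)) : Prop :=
  ∃ (m : ℕ) (A : Matrix (Fin m) (Fin d) ℤ) (b : Fin m → ℤ),
    P = {x | ∀ i, (b i : ℝ) ≤ ∑ j, (A i j : ℝ) * x j}

/-- A polytope is a bounded polyhedron. -/
def IsPolytope {d : ℕ} (P : Set (Fin d → ℝ)) : Prop :=
  IsPolyhedron P ∧ Bornology.IsBounded P

/-- A half-open polyhedron: finitely many weak or strict inequalities with integral data.
The set `S` says which inequalities are strict; `S = ∅` is allowed. -/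
def IsHalfOpenPolyhedron {d : ℕ} (P : Set (Fin d → ℝ)) : Prop :=
  ∃ (m : ℕ) (A : Matrix (Fin m) (Fin d) ℤ) (b : Fin m → ℤ) (S : Set (Fin m)),
    P = {x | (∀ i ∉ S, (b i : ℝ) ≤ ∑ j, (A i j : ℝ) * x j) ∧
             (∀ i ∈ S, (b i : ℝ) < ∑ j, (A i j : ℝ) * x j)}

/-- A half-open polytope is a bounded half-open polyhedron. -/
def IsHalfOpenPolytope {d : ℕ} (P : Set (Fin d → ℝ)) : Prop :=
  IsHalfOpenPolyhedron P ∧ Bornology.IsBounded P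

/-- A partial polytopal complex is a set that is a (finite) disjoint union of half-open
polytopes. -/
def IsPartialPolytopalComplex {d : ℕ} (X : Set (Fin d → ℝ)) : Prop :=
  ∃ (n : ℕ) (Q : Fin n → Set (Fin d → ℝ)),
    (∀ i, IsHalfOpenPolytope (Q i)) ∧ Pairwise (fun i j => Disjoint (Q i) (Q j)) ∧
      X = ⋃ i, Q i

/-- The integer points `ℤ^d ∩ k X`. -/
def latticePoints {d : ℕ} (X : Set (Fin d → ℝ)) (k : ℕ) : Set (Fin d → ℤ) :=
  {z | (fun j => (z j : ℝ)) ∈ (k : ℝ) • X}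

/-- The Ehrhart function `k ↦ #(ℤ^d ∩ k X)`; it is only used for `k ≥ 1`. -/
noncomputable def ehr {d : ℕ} (X : Set (Fin d → ℝ)) (k : ℕ) : ℕ :=
  (latticePoints X k).ncard

/-- `q : ℤ → ℚ` is a quasipolynomial with constituents `c 0, …, c (ℓ - 1)` for some `c`,
that is, a quasipolynomial having `ℓ ≥ 1` as a period. -/
def IsQuasipolynomialWithPeriod (q : ℤ → ℚ) (ℓ : ℕ) : Prop :=
  1 ≤ ℓ ∧ ∃ c : Fin ℓ → Polynomial ℚ,
    ∀ (k : ℤ) (r : Fin ℓ), k ≡ (r : ℕ) [ZMOD ℓ] → q k = (c r).eval (k : ℚ)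

/-- A quasipolynomial, of some period. -/
def IsQuasipolynomial (q : ℤ → ℚ) : Prop :=
  ∃ ℓ : ℕ, IsQuasipolynomialWithPeriod q ℓ

/-- `f`, regarded as defined at the positive integers only, is given by `q`. -/
def AgreesOnPositive (f : ℕ → ℕ) (q : ℤ → ℚ) : Prop :=
  ∀ k : ℕ, 1 ≤ k → (f k : ℚ) = q k

/-- The least common multiple of the (reduced) denominators of all coordinates of the
points of `V`. -/
def lcmDenominators {d : ℕ} (V : Finset (Fin d → ℚ)) : ℕ :=
  V.lcm fun v => Finset.univ.lcm fun j => (v j).den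

end EhrhartTheory

open scoped Pointwise

namespace EhrhartTheory

/-! A polytope is the convex hull of its vertices (Krein–Milman), and a vertex is rational because
the equations active at it determine it. Among all ways of writing a point as a convex combination
of the vertices, select the one with lexicographically smallest coefficient vector. The supports
that occur are the faces of a triangulation, so lattice points of kP correspond bijectively to
vectors c ≥ 0 of total mass k with such a support that combine the vertices to a lattice point
(`exists_coeff_isLexFace`, `IsLexFace.coeff_unique`).

Let ℓ clear the denominators of the vertices. Each c is uniquely f + ℓn with n natural, 0 < f_i ≤ ℓ
on the support of c and f_i = n_i = 0 off it. Then f again represents a lattice point on the same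
face, and only finitely many f occur. For fixed f with mass s and support W, the number of n is the
binomial coefficient of (k - s)/ℓ + |W| - 1 over |W| - 1 if k ≡ s mod ℓ, and zero otherwise. Since s
≤ |W|ℓ, this formula is correct for every k ≥ 1, not only for large k
(`hasQuasiPeriod_card_multiplicities`, `hasQuasiPeriod_ncard_latticeCoeffs`).

Strict inequalities merely select which open faces of the triangulation are counted, and disjoint
unions add the counts. -/

/-! ### Lexicographic minima and the triangulation -/

/-- The first nonzero entry of `w` is negative. -/
def LexNeg {N : ℕ} (w : Fin N → ℝ) : Prop :=
  ∃ j, w j < 0 ∧ ∀ i < j, w i = 0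

lemma lexNeg_or_lexNeg_neg {N : ℕ} {w : Fin N → ℝ} (hw : w ≠ 0) : LexNeg w ∨ LexNeg (-w) := by
  classical
  have hne : (Finset.univ.filter fun i => w i ≠ 0).Nonempty := by
    obtain ⟨i, hi⟩ := Function.ne_iff.mp hw
    exact ⟨i, by simpa using hi⟩
  obtain ⟨j, hj, hmin⟩ := Finset.exists_min_image _ id hne
  have hj0 : w j ≠ 0 := by simpa using hj
  have hz : ∀ i < j, w i = 0 := by
    intro i hi
    by_contra h
    exact absurd (hmin i (by simpa using h)) (not_le.mpr hi)
  rcases lt_or_gt_of_ne hj0 with h | h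
  · exact Or.inl ⟨j, h, hz⟩
  · exact Or.inr ⟨j, by simpa using h, fun i hi => by simp [hz i hi]⟩

lemma LexNeg.not_neg {N : ℕ} {w : Fin N → ℝ} (hw : LexNeg w) : ¬ LexNeg (-w) := by
  rintro ⟨j', hj', hz'⟩
  obtain ⟨j, hj, hz⟩ := hw
  simp only [Pi.neg_apply, neg_eq_zero] at hj' hz'
  rcases lt_trichotomy j j' with h | rfl | h
  · linarith [hz' j h]
  · linarith
  · linarith [hz j' h]

lemma LexNeg.smul {N : ℕ} {w : Fin N → ℝ} (hw : LexNeg w) {r : ℝ} (hr : 0 < r) :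
    LexNeg (r • w) := by
  obtain ⟨j, hj, hz⟩ := hw
  exact ⟨j, mul_neg_of_pos_of_neg hr hj, fun i hi => by simp [hz i hi]⟩

/-- A nonempty compact set of real vectors has a lexicographically smallest element. -/
lemma exists_lexMin {N : ℕ} {K : Set (Fin N → ℝ)} (hK : IsCompact K) (hne : K.Nonempty) :
    ∃ c ∈ K, ∀ c' ∈ K, ¬ LexNeg (c' - c) := by
  -- `L` results from minimizing the first `m` coordinates one after the other; whatever it discards
  -- is lexicographically larger than all it keeps.
  have key : ∀ m : ℕ, ∃ L ⊆ K, IsCompact L ∧ L.Nonempty ∧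
      (∀ c ∈ L, ∀ c' ∈ L, ∀ i : Fin N, i.1 < m → c i = c' i) ∧
      ∀ c ∈ L, ∀ c' ∈ K, c' ∈ L ∨ LexNeg (c - c') := by
    intro m
    induction m with
    | zero =>
      exact ⟨K, subset_rfl, hK, hne, fun _ _ _ _ j hj => absurd hj (Nat.not_lt_zero _),
        fun _ _ _ h => Or.inl h⟩
    | succ m ih =>
      obtain ⟨L, hLK, hL, hLne, hagree, hmin⟩ := ih
      by_cases hm : m < N
      · obtain ⟨c₀, hc₀, hc₀min⟩ := hL.exists_isMinOn hLne
          (continuous_apply (⟨m, hm⟩ : Fin N)).continuousOn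
        refine ⟨L ∩ {c | c ⟨m, hm⟩ = c₀ ⟨m, hm⟩}, Set.inter_subset_left.trans hLK,
          hL.inter_right (isClosed_eq (continuous_apply _) continuous_const), ⟨c₀, hc₀, rfl⟩,
          ?_, ?_⟩
        · rintro c ⟨hc, hcm⟩ c' ⟨hc', hcm'⟩ i hi
          rcases Nat.lt_succ_iff_lt_or_eq.mp hi with h | h
          · exact hagree c hc c' hc' i h
          · obtain rfl : i = ⟨m, hm⟩ := Fin.ext h
            exact hcm.trans hcm'.symm
        · rintro c ⟨hc, hcm⟩ c' hc'
          rcases hmin c hc c' hc' with h | h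
          · have hle : c₀ ⟨m, hm⟩ ≤ c' ⟨m, hm⟩ := hc₀min h
            rcases hle.eq_or_lt with e | e
            · exact Or.inl ⟨h, e.symm⟩
            · refine Or.inr ⟨⟨m, hm⟩, ?_, fun i hi => ?_⟩
              · have hcm : c ⟨m, hm⟩ = c₀ ⟨m, hm⟩ := hcm
                simp only [Pi.sub_apply]
                linarith
              · simp [hagree c hc c' h i hi]
          · exact Or.inr h
      · exact ⟨L, hLK, hL, hLne, fun c hc c' hc' j _ => hagree c hc c' hc' j (by omega), hmin⟩
  obtain ⟨L, hLK, -, ⟨c, hc⟩, hagree, hmin⟩ := key N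
  refine ⟨c, hLK hc, fun c' hc' hneg => ?_⟩
  rcases hmin c hc c' hc' with h | h
  · obtain rfl : c = c' := funext fun i => hagree c hc c' h i i.2
    obtain ⟨j, hj, -⟩ := hneg
    simp at hj
  · exact hneg.not_neg (by simpa using h)

/-- The affine relations among `v` which are nonnegative outside `W` are not lexicographically
negative. The sets `W` with this property are the faces of a triangulation of the convex hull
of `v` without new vertices. -/
def IsLexFace {N : ℕ} {E : Type*} [AddCommGroup E] [Module ℝ E] (v : Fin N → E)
    (W : Set (Fin N)) : Prop :=
  ∀ w : Fin N → ℝ, ∑ i, w i = 0 → ∑ i, w i • v i = 0 → (∀ i ∉ W, 0 ≤ w i) → ¬ LexNeg w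

/-- Nonnegative coefficients supported on a face of the triangulation are determined by their
total mass and the point they represent. -/
lemma IsLexFace.coeff_unique {N : ℕ} {E : Type*} [AddCommGroup E] [Module ℝ E] {v : Fin N → E}
    {c c' : Fin N → ℝ} (hc : IsLexFace v (Function.support c))
    (hc' : IsLexFace v (Function.support c')) (hc0 : ∀ i, 0 ≤ c i) (hc0' : ∀ i, 0 ≤ c' i)
    (hsum : ∑ i, c i = ∑ i, c' i) (hpt : ∑ i, c i • v i = ∑ i, c' i • v i) : c = c' := by
  by_contra hne
  -- The difference of the two vectors is an affine relation, and it can be negative only on the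
  -- support of the vector subtracted.
  rcases lexNeg_or_lexNeg_neg (sub_ne_zero.mpr hne) with h | h
  · refine hc' _ ?_ ?_ ?_ h
    · simp [hsum]
    · simp [sub_smul, hpt]
    · intro i hi
      simpa [Function.notMem_support.mp hi] using hc0 i
  · refine hc _ ?_ ?_ ?_ h
    · simp [hsum]
    · simp [sub_smul, hpt]
    · intro i hi
      simpa [Function.notMem_support.mp hi] using hc0' i

/-- Every point of the convex hull lies in a face of the triangulation. -/
lemma exists_coeff_isLexFace {N d : ℕ} (v : Fin N → Fin d → ℝ) {x : Fin d → ℝ}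
    (hx : x ∈ convexHull ℝ (Set.range v)) :
    ∃ c : Fin N → ℝ, (∀ i, 0 ≤ c i) ∧ ∑ i, c i = 1 ∧ ∑ i, c i • v i = x ∧
      IsLexFace v (Function.support c) := by
  classical
  set K : Set (Fin N → ℝ) := stdSimplex ℝ (Fin N) ∩ {c | ∑ i, c i • v i = x} with hKdef
  have hK : IsCompact K :=
    (isCompact_stdSimplex ℝ (Fin N)).inter_right (isClosed_eq (by fun_prop) continuous_const)
  have hne : K.Nonempty := by
    obtain ⟨ι, _, w, z, hw0, hw1, hz, rfl⟩ := mem_convexHull_iff_exists_fintype.1 hx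
    choose g hg using hz
    refine ⟨fun i => ∑ a with g a = i, w a, ⟨fun i => Finset.sum_nonneg fun a _ => hw0 a, ?_⟩, ?_⟩
    · rw [← hw1]
      exact Finset.sum_fiberwise _ _ _
    · simp only [Set.mem_ofPred_eq, Finset.sum_smul]
      rw [← Finset.sum_fiberwise Finset.univ g]
      refine Finset.sum_congr rfl fun i _ => Finset.sum_congr rfl fun a ha => ?_
      rw [← hg a, (Finset.mem_filter.mp ha).2]
  obtain ⟨c, ⟨⟨hc0, hc1⟩, hcx⟩, hmin⟩ := exists_lexMin hK hne
  refine ⟨c, hc0, hc1, hcx, fun w hw0 hwv hwnn hneg => ?_⟩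
  -- A violating relation `w` is nonnegative where `c` vanishes, so `c + r • w` is still an
  -- admissible representation for small `r > 0`, yet lexicographically smaller.
  have hev : ∀ᶠ r : ℝ in nhdsWithin 0 (Set.Ioi 0), ∀ i, 0 ≤ c i + r * w i := by
    rw [Filter.eventually_all]
    intro i
    by_cases hi : c i = 0
    · filter_upwards [self_mem_nhdsWithin] with r hr
      have := hwnn i (by simpa using hi)
      have hr : (0 : ℝ) < r := hr
      rw [hi]
      positivity
    · have hpos : 0 < c i := lt_of_le_of_ne (hc0 i) (Ne.symm hi)
      have ht : Filter.Tendsto (fun r : ℝ => c i + r * w i) (nhdsWithin 0 (Set.Ioi 0))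
          (nhds (c i + 0 * w i)) :=
        ((by fun_prop : Continuous fun r : ℝ => c i + r * w i).tendsto 0).mono_left
          nhdsWithin_le_nhds
      have := ht.eventually (lt_mem_nhds (a := 0) (by simpa using hpos))
      exact this.mono fun r hr => hr.le
  obtain ⟨r, hr, hr0⟩ := (hev.and self_mem_nhdsWithin).exists
  refine hmin (c + r • w) ⟨⟨hr, ?_⟩, ?_⟩ ?_
  · simp [Finset.sum_add_distrib, ← Finset.mul_sum, hw0, hc1]
  · have hcx : ∑ i, c i • v i = x := hcx
    simp [add_smul, Finset.sum_add_distrib, mul_smul, ← Finset.smul_sum, hwv, hcx]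
  · simpa using hneg.smul hr0

/-! ### Vertices of rational polyhedra -/

/-- An extreme point of a polyhedron is the only solution of the equations active at it. -/
lemma eq_of_mem_extremePoints {m d : ℕ} {A : Matrix (Fin m) (Fin d) ℤ} {b : Fin m → ℤ}
    {x y : Fin d → ℝ}
    (hx : x ∈ Set.extremePoints ℝ {x : Fin d → ℝ | ∀ i, (b i : ℝ) ≤ ∑ j, (A i j : ℝ) * x j})
    (hy : ∀ i, ∑ j, (A i j : ℝ) * x j = b i → ∑ j, (A i j : ℝ) * y j = b i) : y = x := by
  obtain ⟨hxP, hext⟩ := mem_extremePoints_iff_left.mp hx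
  -- For small `r > 0` both x ± r(y - x) lie in the polyhedron: active constraints are constant
  -- along the line, the others have slack. Extremality of the midpoint x then forces y = x.
  have hev : ∀ᶠ r : ℝ in nhdsWithin 0 (Set.Ioi 0), ∀ i,
      (b i : ℝ) ≤ ∑ j, (A i j : ℝ) * (x j + r * (y j - x j)) ∧
      (b i : ℝ) ≤ ∑ j, (A i j : ℝ) * (x j - r * (y j - x j)) := by
    rw [Filter.eventually_all]
    intro i
    have e1 : ∀ r : ℝ, ∑ j, (A i j : ℝ) * (x j + r * (y j - x j)) =
        ∑ j, (A i j : ℝ) * x j + r * (∑ j, (A i j : ℝ) * y j - ∑ j, (A i j : ℝ) * x j) := by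
      intro r
      rw [← Finset.sum_sub_distrib, Finset.mul_sum, ← Finset.sum_add_distrib]
      exact Finset.sum_congr rfl fun j _ => by ring
    have e2 : ∀ r : ℝ, ∑ j, (A i j : ℝ) * (x j - r * (y j - x j)) =
        ∑ j, (A i j : ℝ) * x j - r * (∑ j, (A i j : ℝ) * y j - ∑ j, (A i j : ℝ) * x j) := by
      intro r
      rw [← Finset.sum_sub_distrib, Finset.mul_sum, ← Finset.sum_sub_distrib]
      exact Finset.sum_congr rfl fun j _ => by ring
    simp only [e1, e2]
    rcases (hxP i).eq_or_lt with h | h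
    · rw [hy i h.symm, ← h]
      simp
    · generalize ∑ j, (A i j : ℝ) * x j = a at h ⊢
      generalize ∑ j, (A i j : ℝ) * y j = a' at h ⊢
      have t1 := ((by fun_prop : Continuous fun r : ℝ => a + r * (a' - a)).tendsto 0).mono_left
          (nhdsWithin_le_nhds (s := Set.Ioi 0))
      have t2 := ((by fun_prop : Continuous fun r : ℝ => a - r * (a' - a)).tendsto 0).mono_left
          (nhdsWithin_le_nhds (s := Set.Ioi 0))
      filter_upwards [t1.eventually (lt_mem_nhds (a := (b i : ℝ)) (by simpa using h)),
        t2.eventually (lt_mem_nhds (a := (b i : ℝ)) (by simpa using h))] with r h1 h2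
      exact ⟨h1.le, h2.le⟩
  obtain ⟨r, hr, hr0⟩ := (hev.and self_mem_nhdsWithin).exists
  have hr0 : (0 : ℝ) < r := hr0
  have := hext (fun j => x j + r * (y j - x j)) (fun i => (hr i).1)
    (fun j => x j - r * (y j - x j)) (fun i => (hr i).2)
    ⟨1 / 2, 1 / 2, by norm_num, by norm_num, by norm_num, by
      funext j
      simp only [Pi.add_apply, Pi.smul_apply, smul_eq_mul]
      ring⟩
  funext j
  have hj := congrFun this j
  have : r * (y j - x j) = 0 := by linarith
  rcases mul_eq_zero.mp this with h | h <;> linarith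

/-- An extreme point is determined by its set of active constraints, and there are finitely many
such sets. -/
lemma finite_extremePoints_polyhedron {m d : ℕ} (A : Matrix (Fin m) (Fin d) ℤ) (b : Fin m → ℤ) :
    (Set.extremePoints ℝ
      {x : Fin d → ℝ | ∀ i, (b i : ℝ) ≤ ∑ j, (A i j : ℝ) * x j}).Finite := by
  refine Set.Finite.of_finite_image
    (f := fun x : Fin d → ℝ => {i : Fin m | ∑ j, (A i j : ℝ) * x j = b i}) (Set.toFinite _) ?_
  intro x hx y _ hxy
  refine (eq_of_mem_extremePoints hx fun i hi => ?_).symm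
  exact (Set.ext_iff.mp hxy i).mp hi

/-- Extreme points of rational polyhedra are rational: a `ℚ`-linear retraction `ℝ → ℚ` fixes
them, by uniqueness. -/
lemma exists_rat_of_mem_extremePoints {m d : ℕ} {A : Matrix (Fin m) (Fin d) ℤ} {b : Fin m → ℤ}
    {x : Fin d → ℝ}
    (hx : x ∈ Set.extremePoints ℝ {x : Fin d → ℝ | ∀ i, (b i : ℝ) ≤ ∑ j, (A i j : ℝ) * x j}) :
    ∃ y : Fin d → ℚ, (fun j => (y j : ℝ)) = x := by
  obtain ⟨f, hf⟩ := (Algebra.linearMap ℚ ℝ).exists_leftInverse_of_injective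
    (LinearMap.ker_eq_bot.mpr (algebraMap ℚ ℝ).injective)
  have hf1 : ∀ q : ℚ, f (q : ℝ) = q := fun q => by simpa using LinearMap.congr_fun hf q
  refine ⟨fun j => f (x j), eq_of_mem_extremePoints hx fun i hi => ?_⟩
  have h := congrArg f hi
  rw [map_sum] at h
  have e : ∀ j, f ((A i j : ℝ) * x j) = (A i j : ℚ) * f (x j) := fun j => by
    rw [← zsmul_eq_mul, map_zsmul, zsmul_eq_mul]
  have hb : f ((b i : ℝ)) = (b i : ℚ) := by simpa using hf1 (b i)
  simp only [e, hb] at h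
  exact_mod_cast congrArg (fun q : ℚ => (q : ℝ)) h

lemma isClosed_polyhedron {m d : ℕ} (A : Matrix (Fin m) (Fin d) ℤ) (b : Fin m → ℤ) :
    IsClosed {x : Fin d → ℝ | ∀ i, (b i : ℝ) ≤ ∑ j, (A i j : ℝ) * x j} := by
  simp only [Set.ofPred_forall]
  exact isClosed_iInter fun i => isClosed_le continuous_const (by fun_prop)

lemma convex_polyhedron {m d : ℕ} (A : Matrix (Fin m) (Fin d) ℤ) (b : Fin m → ℤ) :
    Convex ℝ {x : Fin d → ℝ | ∀ i, (b i : ℝ) ≤ ∑ j, (A i j : ℝ) * x j} := by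
  intro x hx y hy s t hs ht hst i
  have e : ∑ j, (A i j : ℝ) * (s • x + t • y) j =
      s * ∑ j, (A i j : ℝ) * x j + t * ∑ j, (A i j : ℝ) * y j := by
    rw [Finset.mul_sum, Finset.mul_sum, ← Finset.sum_add_distrib]
    refine Finset.sum_congr rfl fun j _ => ?_
    simp only [Pi.add_apply, Pi.smul_apply, smul_eq_mul]
    ring
  rw [e]
  calc (b i : ℝ) = s * b i + t * b i := by rw [← add_mul, hst, one_mul]
    _ ≤ _ := add_le_add (mul_le_mul_of_nonneg_left (hx i) hs) (mul_le_mul_of_nonneg_left (hy i) ht)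

/-- A polytope is the convex hull of its vertices, which are finitely many rational points. -/
lemma exists_vertices {m d : ℕ} (A : Matrix (Fin m) (Fin d) ℤ) (b : Fin m → ℤ)
    (hbd : Bornology.IsBounded {x : Fin d → ℝ | ∀ i, (b i : ℝ) ≤ ∑ j, (A i j : ℝ) * x j}) :
    ∃ V : Finset (Fin d → ℚ),
      (fun (v : Fin d → ℚ) (j : Fin d) => (v j : ℝ)) '' (V : Set (Fin d → ℚ)) =
        Set.extremePoints ℝ {x : Fin d → ℝ | ∀ i, (b i : ℝ) ≤ ∑ j, (A i j : ℝ) * x j} ∧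
      convexHull ℝ ((fun (v : Fin d → ℚ) (j : Fin d) => (v j : ℝ)) '' (V : Set (Fin d → ℚ))) =
        {x : Fin d → ℝ | ∀ i, (b i : ℝ) ≤ ∑ j, (A i j : ℝ) * x j} := by
  have hfin := finite_extremePoints_polyhedron A b
  have hinj : Function.Injective fun (v : Fin d → ℚ) (j : Fin d) => (v j : ℝ) := fun v w h =>
    funext fun j => Rat.cast_injective (congrFun h j)
  have hV : (fun (v : Fin d → ℚ) (j : Fin d) => (v j : ℝ)) ''
      ((hfin.preimage hinj.injOn).toFinset : Set (Fin d → ℚ)) =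
        Set.extremePoints ℝ {x : Fin d → ℝ | ∀ i, (b i : ℝ) ≤ ∑ j, (A i j : ℝ) * x j} := by
    rw [Set.Finite.coe_toFinset]
    exact Set.image_preimage_eq_of_subset fun x hx => exists_rat_of_mem_extremePoints hx
  refine ⟨_, hV, ?_⟩
  rw [hV, ← (hfin.isClosed_convexHull ℝ).closure_eq]
  exact closure_convexHull_extremePoints
    (Metric.isCompact_of_isClosed_isBounded (isClosed_polyhedron A b) hbd) (convex_polyhedron A b)

/-! ### Closure properties of quasipolynomials -/

/-- On the positive integers, `f` is a quasipolynomial with period `ℓ`. -/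
def HasQuasiPeriod (f : ℕ → ℕ) (ℓ : ℕ) : Prop :=
  ∃ q : ℤ → ℚ, IsQuasipolynomialWithPeriod q ℓ ∧ AgreesOnPositive f q

lemma HasQuasiPeriod.congr {f g : ℕ → ℕ} {ℓ : ℕ} (hf : HasQuasiPeriod f ℓ)
    (h : ∀ k, 1 ≤ k → g k = f k) : HasQuasiPeriod g ℓ := by
  obtain ⟨q, hq, hfq⟩ := hf
  exact ⟨q, hq, fun k hk => by rw [h k hk, hfq k hk]⟩

lemma HasQuasiPeriod.zero {ℓ : ℕ} (hℓ : 1 ≤ ℓ) : HasQuasiPeriod (fun _ => 0) ℓ :=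
  ⟨fun _ => 0, ⟨hℓ, fun _ => 0, by simp⟩, fun _ _ => by simp⟩

lemma HasQuasiPeriod.add {f g : ℕ → ℕ} {ℓ : ℕ} (hf : HasQuasiPeriod f ℓ)
    (hg : HasQuasiPeriod g ℓ) : HasQuasiPeriod (fun k => f k + g k) ℓ := by
  obtain ⟨p, ⟨hℓ, c, hc⟩, hfp⟩ := hf
  obtain ⟨q, ⟨_, e, he⟩, hgq⟩ := hg
  refine ⟨fun k => p k + q k, ⟨hℓ, fun r => c r + e r, fun k r hr => ?_⟩, fun k hk => ?_⟩
  · simp [hc k r hr, he k r hr]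
  · push_cast
    rw [hfp k hk, hgq k hk]

lemma HasQuasiPeriod.sum {ι : Type*} {ℓ : ℕ} (hℓ : 1 ≤ ℓ) (s : Finset ι) {f : ι → ℕ → ℕ}
    (hf : ∀ i ∈ s, HasQuasiPeriod (f i) ℓ) : HasQuasiPeriod (fun k => ∑ i ∈ s, f i k) ℓ := by
  classical
  induction s using Finset.induction_on with
  | empty => simpa using HasQuasiPeriod.zero hℓ
  | insert a s ha ih =>
    simp only [Finset.sum_insert ha]
    exact (hf a (Finset.mem_insert_self a s)).add
      (ih fun i hi => hf i (Finset.mem_insert_of_mem hi))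

lemma HasQuasiPeriod.of_dvd {f : ℕ → ℕ} {ℓ L : ℕ} (hf : HasQuasiPeriod f ℓ) (hL : 1 ≤ L)
    (h : ℓ ∣ L) : HasQuasiPeriod f L := by
  obtain ⟨q, ⟨hℓ, c, hc⟩, hfq⟩ := hf
  refine ⟨q, ⟨hL, fun r => c ⟨r % ℓ, Nat.mod_lt _ hℓ⟩, fun k r hr => hc k _ ?_⟩, hfq⟩
  refine (hr.of_dvd (Int.natCast_dvd_natCast.mpr h)).trans ?_
  simpa using (Int.mod_modEq (r : ℤ) ℓ).symm

lemma HasQuasiPeriod.of_residues {f : ℕ → ℕ} {ℓ : ℕ} (hℓ : 1 ≤ ℓ) (c : ℕ → Polynomial ℚ)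
    (h : ∀ k, 1 ≤ k → (f k : ℚ) = (c (k % ℓ)).eval (k : ℚ)) : HasQuasiPeriod f ℓ := by
  refine ⟨fun k => (c (k % ℓ).toNat).eval (k : ℚ), ⟨hℓ, fun r => c r, fun k r hr => ?_⟩,
    fun k hk => ?_⟩
  · have hr : k % ℓ = r := by
      rw [hr, Int.emod_eq_of_lt (by positivity) (by exact_mod_cast r.2)]
    simp [hr]
  · have : ((k : ℤ) % (ℓ : ℤ)).toNat = k % ℓ := by
      rw [← Int.natCast_mod, Int.toNat_natCast]
    simp only [this]
    simpa using h k hk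

/-! ### Counting the multiplicity vectors -/

lemma card_piAntidiag {ι : Type*} [DecidableEq ι] (s : Finset ι) (n : ℕ) :
    (s.piAntidiag n).card = (s.card + n - 1).choose n := by
  rw [← Finset.card_finsuppAntidiag_nat_eq_choose, Finset.finsuppAntidiag, Finset.card_map,
    Finset.card_attach]

/-- The functions `n` supported in `W` with `s + ℓ * ∑ i, n i = k`. -/
def multiplicities {ι : Type*} [DecidableEq ι] (W : Finset ι) (ℓ s k : ℕ) : Finset (ι → ℕ) :=
  if s ≤ k ∧ ℓ ∣ k - s then W.piAntidiag ((k - s) / ℓ) else ∅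

lemma mem_multiplicities {ι : Type*} [DecidableEq ι] {W : Finset ι} {ℓ s k : ℕ} (hℓ : 1 ≤ ℓ)
    {n : ι → ℕ} :
    n ∈ multiplicities W ℓ s k ↔ s + ℓ * ∑ i ∈ W, n i = k ∧ ∀ i, n i ≠ 0 → i ∈ W := by
  unfold multiplicities
  split_ifs with h
  · obtain ⟨h1, t, ht⟩ := h
    rw [Finset.mem_piAntidiag, ht, Nat.mul_div_cancel_left _ hℓ]
    refine and_congr_left fun _ => ⟨fun h => by rw [h]; omega, fun h => ?_⟩
    exact Nat.eq_of_mul_eq_mul_left hℓ (show ℓ * ∑ i ∈ W, n i = ℓ * t by omega)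
  · simp only [Finset.notMem_empty, false_iff, not_and]
    rintro rfl
    exact absurd ⟨Nat.le_add_right _ _, by simp⟩ h

/-- The bound on `s` makes the binomial polynomial vanish at all positive `k < s`. -/
lemma hasQuasiPeriod_card_multiplicities {ι : Type*} [DecidableEq ι] {W : Finset ι} {ℓ s : ℕ}
    (hℓ : 1 ≤ ℓ) (hW : W.Nonempty) (hs : s ≤ W.card * ℓ) :
    HasQuasiPeriod (fun k => (multiplicities W ℓ s k).card) ℓ := by
  obtain ⟨p, hp⟩ : ∃ p, W.card = p + 1 := ⟨W.card - 1, by have := hW.card_pos; omega⟩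
  rw [hp] at hs
  have hℓ0 : (ℓ : ℚ) ≠ 0 := by positivity
  refine HasQuasiPeriod.of_residues hℓ (fun r => if r = s % ℓ then
    Polynomial.C ((p.factorial : ℚ)⁻¹) * (descPochhammer ℚ p).comp
      (Polynomial.C ((ℓ : ℚ)⁻¹) * (Polynomial.X - Polynomial.C (s : ℚ)) + Polynomial.C (p : ℚ))
    else 0) fun k hk => ?_
  by_cases hmod : k % ℓ = s % ℓ
  · rw [if_pos hmod]
    obtain ⟨u, hu⟩ : ℓ ∣ k + (p + 1) * ℓ - s := by
      refine (Nat.modEq_iff_dvd' (by omega)).mp ?_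
      simp [Nat.ModEq, hmod]
    have hu' : k + (p + 1) * ℓ = s + ℓ * u := by omega
    -- Here T = (k - s)/ℓ + p as an integer; `u = 0` would give k ≤ 0 by the bound on `s`, so T is a
    -- natural number.
    obtain ⟨T, rfl⟩ : ∃ T, u = T + 1 := by
      refine ⟨u - 1, ?_⟩
      rcases Nat.eq_zero_or_pos u with rfl | h
      · simp at hu'; omega
      · omega
    have hT : (multiplicities W ℓ s k).card = T.choose p := by
      unfold multiplicities
      split_ifs with h
      · obtain ⟨h1, t, ht⟩ := h
        have : t + p = T := by
          have : ℓ * (t + p) = ℓ * T := by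
            have : k = s + ℓ * t := by omega
            subst this
            linarith
          exact Nat.eq_of_mul_eq_mul_left hℓ this
        rw [card_piAntidiag, hp, ht, Nat.mul_div_cancel_left _ hℓ, ← this,
          show p + 1 + t - 1 = t + p by omega, Nat.choose_symm_add]
      -- This is the case k < s, where T < p and the binomial coefficient vanishes as required.
      · rw [Finset.card_empty, Nat.choose_eq_zero_of_lt]
        by_contra hle
        push Not at hle
        obtain ⟨t, rfl⟩ := Nat.exists_eq_add_of_le hle
        have : k = s + ℓ * t := by linarith
        exact h ⟨by omega, ⟨t, by omega⟩⟩
    have hev : (ℓ : ℚ)⁻¹ * ((k : ℚ) - s) + p = T := by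
      have : (k : ℚ) + (p + 1) * ℓ = s + ℓ * (T + 1) := by exact_mod_cast hu'
      field_simp
      linarith
    rw [hT, Nat.cast_choose_eq_descPochhammer_div]
    simp only [Polynomial.eval_mul, Polynomial.eval_C, Polynomial.eval_comp, Polynomial.eval_add,
      Polynomial.eval_sub, Polynomial.eval_X, hev]
    rw [div_eq_inv_mul]
  · rw [if_neg hmod, multiplicities, if_neg]
    · simp
    · rintro ⟨h1, h2⟩
      exact hmod ((Nat.modEq_iff_dvd' h1).mpr h2).symm

/-! ### Coefficient vectors and their box decomposition -/

/-- Nonnegative coefficient vectors of total mass `k` with support in `G`, for which the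
corresponding combination of the points `v` is a lattice point. -/
def latticeCoeffs {N d : ℕ} (v : Fin N → Fin d → ℝ) (G : Set (Set (Fin N))) (k : ℕ) :
    Set (Fin N → ℝ) :=
  {c | (∀ i, 0 ≤ c i) ∧ ∑ i, c i = k ∧ Function.support c ∈ G ∧
    ∃ z : Fin d → ℤ, ∑ i, c i • v i = fun j => (z j : ℝ)}

/-- On faces of the triangulation a coefficient vector of mass `k` is determined by its lattice
point, and these points are bounded. -/
lemma finite_latticeCoeffs {N d : ℕ} (v : Fin N → Fin d → ℝ) {G : Set (Set (Fin N))}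
    (hG : ∀ W ∈ G, IsLexFace v W) (k : ℕ) : (latticeCoeffs v G k).Finite := by
  choose! z hz using fun (c : Fin N → ℝ) (hc : c ∈ latticeCoeffs v G k) => hc.2.2.2
  obtain ⟨B, hB⟩ : ∃ B : ℤ, ∀ j, ∑ i, (k : ℝ) * |v i j| ≤ B := by
    obtain ⟨B, hB⟩ := exists_nat_ge (∑ j, ∑ i, (k : ℝ) * |v i j|)
    refine ⟨B, fun j => le_trans ?_ hB⟩
    exact Finset.single_le_sum (f := fun j => ∑ i, (k : ℝ) * |v i j|)
      (fun j _ => Finset.sum_nonneg fun i _ => by positivity) (Finset.mem_univ j)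
  refine Set.Finite.of_finite_image (f := z)
    ((Set.finite_Icc (fun _ : Fin d => -B) (fun _ => B)).subset ?_) ?_
  · rintro _ ⟨c, hc, rfl⟩
    have hle : ∀ i, c i ≤ k := fun i => by
      rw [← hc.2.1]
      exact Finset.single_le_sum (fun i _ => hc.1 i) (Finset.mem_univ i)
    have habs : ∀ j, |(z c j : ℝ)| ≤ B := fun j => by
      have := congrFun (hz c hc) j
      simp only [Finset.sum_apply, Pi.smul_apply, smul_eq_mul] at this
      rw [← this]
      refine (Finset.abs_sum_le_sum_abs _ _).trans (le_trans (Finset.sum_le_sum fun i _ => ?_) (hB j))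
      rw [abs_mul, abs_of_nonneg (hc.1 i)]
      exact mul_le_mul_of_nonneg_right (hle i) (abs_nonneg _)
    exact ⟨fun j => by exact_mod_cast (abs_le.mp (habs j)).1,
      fun j => by exact_mod_cast (abs_le.mp (habs j)).2⟩
  · intro c hc c' hc' h
    refine (hG _ hc.2.2.1).coeff_unique (hG _ hc'.2.2.1) hc.1 hc'.1
      (hc.2.1.trans hc'.2.1.symm) ?_
    rw [hz c hc, hz c' hc', h]

/-- The elements of `latticeCoeffs` all of whose entries are at most `ℓ`. -/
def boxCoeffs {N d : ℕ} (v : Fin N → Fin d → ℝ) (G : Set (Set (Fin N))) (ℓ : ℕ) :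
    Set (Fin N → ℝ) :=
  {c | (∀ i, c i ≤ ℓ) ∧ ∃ s, c ∈ latticeCoeffs v G s}

lemma finite_boxCoeffs {N d : ℕ} (v : Fin N → Fin d → ℝ) {G : Set (Set (Fin N))}
    (hG : ∀ W ∈ G, IsLexFace v W) (ℓ : ℕ) : (boxCoeffs v G ℓ).Finite := by
  refine ((Set.finite_Iic (N * ℓ)).biUnion
    fun s _ => finite_latticeCoeffs v hG s).subset ?_
  rintro c ⟨hc, s, hs⟩
  refine Set.mem_biUnion (x := s) ?_ hs
  have h : ∑ i, c i ≤ ∑ _i : Fin N, (ℓ : ℝ) := Finset.sum_le_sum fun i _ => hc i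
  rw [hs.2.1] at h
  simp only [Finset.sum_const, Finset.card_univ, Fintype.card_fin, nsmul_eq_mul] at h
  exact_mod_cast h

/-- Recovers `n` from the sum alone, without knowing `a`; hence the decomposition is unique. -/
lemma ceil_div_sub_one {ℓ : ℕ} (hℓ : 1 ≤ ℓ) {a : ℝ} (ha0 : 0 ≤ a) (ha : a ≤ ℓ) {n : ℕ}
    (hn : a = 0 → n = 0) : ⌈(a + ℓ * n) / ℓ⌉₊ - 1 = n := by
  have hℓ0 : (0 : ℝ) < ℓ := by exact_mod_cast hℓ
  rcases ha0.eq_or_lt with h | h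
  · simp [← h, hn h.symm]
  · have : ⌈(a + ℓ * n) / ℓ⌉₊ = n + 1 := by
      rw [Nat.ceil_eq_iff (by omega)]
      constructor
      · rw [lt_div_iff₀ hℓ0]
        simp only [Nat.add_sub_cancel]
        linarith
      · rw [div_le_iff₀ hℓ0]
        push_cast
        linarith
    omega

/-- The remainder is taken in (0, ℓ] rather than [0, ℓ), so that subtracting multiples of `ℓ` never
shrinks the support. -/
lemma exists_box_add {ℓ : ℕ} (hℓ : 1 ≤ ℓ) {a : ℝ} (ha : 0 ≤ a) :
    ∃ (n : ℕ) (f : ℝ), a = f + ℓ * n ∧ 0 ≤ f ∧ f ≤ ℓ ∧ (f = 0 ↔ a = 0) ∧ (f = 0 → n = 0) := by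
  have hℓ0 : (0 : ℝ) < ℓ := by exact_mod_cast hℓ
  rcases ha.eq_or_lt with rfl | h
  · exact ⟨0, 0, by simp⟩
  · have hpos : 0 < ⌈a / ℓ⌉₊ := Nat.ceil_pos.mpr (by positivity)
    obtain ⟨n, hn⟩ : ∃ n, ⌈a / ℓ⌉₊ = n + 1 := ⟨⌈a / ℓ⌉₊ - 1, by omega⟩
    obtain ⟨h1, h2⟩ := (Nat.ceil_eq_iff (by omega)).mp hn
    rw [lt_div_iff₀ hℓ0, Nat.add_sub_cancel] at h1
    rw [div_le_iff₀ hℓ0] at h2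
    push_cast at h2
    have : 0 < a - ℓ * n := by linarith
    exact ⟨n, a - ℓ * n, by ring, this.le, by linarith, by simp [this.ne', h.ne'],
      fun h => absurd h this.ne'⟩

/-- The number of lattice coefficient vectors is a quasipolynomial: each is uniquely the sum of
a vector in the box `[0, ℓ]^N` and `ℓ` times a natural vector with smaller support. -/
lemma hasQuasiPeriod_ncard_latticeCoeffs {N d ℓ : ℕ} (hℓ : 1 ≤ ℓ) (v : Fin N → Fin d → ℝ)
    (hv : ∀ i j, ∃ z : ℤ, (ℓ : ℝ) * v i j = z) {G : Set (Set (Fin N))}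
    (hG : ∀ W ∈ G, IsLexFace v W) (hGne : ∀ W ∈ G, W.Nonempty) :
    HasQuasiPeriod (fun k => (latticeCoeffs v G k).ncard) ℓ := by
  classical
  have hℓ0 : (0 : ℝ) < ℓ := by exact_mod_cast hℓ
  choose y hy using hv
  set D := (finite_boxCoeffs v hG ℓ).toFinset with hD
  have hDmem : ∀ f, f ∈ D ↔ f ∈ boxCoeffs v G ℓ := fun f => by simp [hD]
  choose! s hs using fun (f : Fin N → ℝ) (hf : f ∈ boxCoeffs v G ℓ) => hf.2
  set W : (Fin N → ℝ) → Finset (Fin N) := fun f => Finset.univ.filter fun i => f i ≠ 0 with hW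
  set M : (Fin N → ℝ) → ℕ → Finset (Fin N → ℕ) := fun f k => multiplicities (W f) ℓ (s f) k with hM
  have hMmem : ∀ f k n, n ∈ M f k ↔ s f + ℓ * ∑ i, n i = k ∧ ∀ i, f i = 0 → n i = 0 := by
    intro f k n
    have hsupp : (∀ i, n i ≠ 0 → i ∈ W f) ↔ ∀ i, f i = 0 → n i = 0 :=
      forall_congr' fun i => by simp only [hW, Finset.mem_filter, Finset.mem_univ, true_and]; tauto
    rw [hM, mem_multiplicities hℓ, hsupp]
    refine and_congr_left fun h => ?_
    rw [Finset.sum_subset (Finset.subset_univ (W f))]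
    intro i _ hi
    exact h i (by simpa [hW] using hi)
  set e : (Fin N → ℝ) → (Fin N → ℕ) → Fin N → ℝ := fun f n i => f i + ℓ * n i with he
  have hrec : ∀ f ∈ D, ∀ k, ∀ n ∈ M f k, (fun i => ⌈e f n i / ℓ⌉₊ - 1) = n := by
    intro f hf k n hn
    have hf := (hDmem f).mp hf
    exact funext fun i => ceil_div_sub_one hℓ ((hs f hf).1 i) (hf.1 i) (((hMmem f k n).mp hn).2 i)
  have hsuppe : ∀ (f : Fin N → ℝ) (n : Fin N → ℕ), (∀ i, 0 ≤ f i) → (∀ i, f i = 0 → n i = 0) →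
      Function.support (e f n) = Function.support f := by
    intro f n hf hn
    ext i
    simp only [he, Function.mem_support, not_iff_not]
    constructor
    · intro h
      have : (0 : ℝ) ≤ ℓ * n i := by positivity
      linarith [hf i]
    · intro h
      simp [h, hn i h]
  -- Adding ℓn moves the represented point by an integral vector, since each ℓ·v i is integral.
  have hpt : ∀ (f : Fin N → ℝ) (n : Fin N → ℕ), ∑ i, e f n i • v i =
      ∑ i, f i • v i + fun j => ((∑ i, n i * y i j : ℤ) : ℝ) := by
    intro f n
    funext j
    simp only [he, Finset.sum_apply, Pi.smul_apply, Pi.add_apply, smul_eq_mul]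
    push_cast
    rw [← Finset.sum_add_distrib]
    refine Finset.sum_congr rfl fun i _ => ?_
    rw [← hy i j]
    ring
  have hsum : ∀ (f : Fin N → ℝ) (n : Fin N → ℕ), ∑ i, e f n i =
      ∑ i, f i + ((ℓ * ∑ i, n i : ℕ) : ℝ) := by
    intro f n
    simp only [he, Finset.sum_add_distrib, ← Finset.mul_sum]
    push_cast
    rfl
  have hdecomp : ∀ k, latticeCoeffs v G k =
      ((D.biUnion fun f => (M f k).image (e f) : Finset (Fin N → ℝ)) : Set (Fin N → ℝ)) := by
    intro k
    ext c
    simp only [Finset.coe_biUnion, Set.mem_iUnion, Finset.mem_coe, Finset.mem_image, exists_prop]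
    constructor
    · rintro ⟨hc0, hck, hcG, z, hz⟩
      choose n f hcf hf0 hfℓ hfc hfn using fun i => exists_box_add hℓ (hc0 i)
      have hcef : e f n = c := funext fun i => (hcf i).symm
      have hle : ℓ * ∑ i, n i ≤ k := by
        have h1 := hsum f n
        rw [hcef, hck] at h1
        have h2 : 0 ≤ ∑ i, f i := Finset.sum_nonneg fun i _ => hf0 i
        exact_mod_cast (show ((ℓ * ∑ i, n i : ℕ) : ℝ) ≤ k by linarith)
      have hfbox : f ∈ latticeCoeffs v G (k - ℓ * ∑ i, n i) := by
        refine ⟨hf0, ?_, ?_, fun j => z j - ∑ i, n i * y i j, ?_⟩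
        · have h1 := hsum f n
          rw [hcef, hck] at h1
          rw [Nat.cast_sub hle]
          linarith
        · rwa [← hsuppe f n hf0 hfn, hcef]
        · have h1 := hpt f n
          rw [hcef, hz] at h1
          funext j
          have h2 := congrFun h1 j
          simp only [Pi.add_apply] at h2
          push_cast at h2 ⊢
          linarith
      have hfD : f ∈ boxCoeffs v G ℓ := ⟨hfℓ, _, hfbox⟩
      refine ⟨f, (hDmem f).mpr hfD, n, (hMmem f k n).mpr ⟨?_, hfn⟩, hcef⟩
      have : ((s f : ℕ) : ℝ) = ((k - ℓ * ∑ i, n i : ℕ) : ℝ) :=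
        (hs f hfD).2.1.symm.trans hfbox.2.1
      have : s f = k - ℓ * ∑ i, n i := by exact_mod_cast this
      omega
    · rintro ⟨f, hf, n, hn, rfl⟩
      have hf := (hDmem f).mp hf
      obtain ⟨hf0, hfs, hfG, z, hz⟩ := hs f hf
      obtain ⟨hnk, hn0⟩ := (hMmem f k n).mp hn
      refine ⟨fun i => add_nonneg (hf0 i) (by positivity), ?_, ?_,
        fun j => z j + ∑ i, n i * y i j, ?_⟩
      · rw [hsum, hfs, ← hnk]
        push_cast
        rfl
      · rwa [hsuppe f n hf0 hn0]
      · rw [hpt, hz]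
        funext j
        simp
  -- The vectors are grouped by their box part; distinct box parts give disjoint groups, because
  -- `hrec` recovers `n` and hence `f`.
  refine (HasQuasiPeriod.sum hℓ D (f := fun f k => (M f k).card) fun f hf => ?_).congr
    fun k _ => ?_
  · have hf := (hDmem f).mp hf
    obtain ⟨hf0, hfs, hfG, -⟩ := hs f hf
    have hsuppW : ∀ i, i ∈ W f ↔ i ∈ Function.support f := fun i => by simp [hW]
    refine hasQuasiPeriod_card_multiplicities hℓ ?_ ?_
    · obtain ⟨i, hi⟩ := hGne _ hfG
      exact ⟨i, (hsuppW i).mpr hi⟩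
    · have h1 : ∑ i ∈ W f, f i = s f := by
        rw [← hfs]
        exact Finset.sum_subset (Finset.subset_univ _) fun i _ hi => by simpa [hW] using hi
      have h2 : ∑ i ∈ W f, f i ≤ ∑ _i ∈ W f, (ℓ : ℝ) := Finset.sum_le_sum fun i _ => hf.1 i
      rw [h1, Finset.sum_const, nsmul_eq_mul] at h2
      exact_mod_cast h2
  · rw [hdecomp k, Set.ncard_coe_finset, Finset.card_biUnion]
    · refine Finset.sum_congr rfl fun f hf => Finset.card_image_of_injOn fun n hn n' hn' h => ?_
      rw [← hrec f hf k n hn, ← hrec f hf k n' hn', h]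
    · intro f hf f' hf' hne
      rw [Function.onFun, Finset.disjoint_left]
      intro c hc hc'
      obtain ⟨n, hn, rfl⟩ := Finset.mem_image.mp hc
      obtain ⟨n', hn', h⟩ := Finset.mem_image.mp hc'
      have hnn : n = n' := by rw [← hrec f hf k n hn, ← hrec f' hf' k n' hn', h]
      subst hnn
      refine hne (funext fun i => ?_)
      have := congrFun h i
      simp only [he] at this
      linarith

/-! ### Lattice points of half-open polytopes -/

lemma finite_latticePoints {d : ℕ} {X : Set (Fin d → ℝ)} (hX : Bornology.IsBounded X) (k : ℕ) :
    (latticePoints X k).Finite := by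
  obtain ⟨R, hR⟩ := (hX.smul₀ (k : ℝ)).exists_norm_le
  obtain ⟨B, hB⟩ := exists_nat_ge R
  refine (Set.finite_Icc (fun _ : Fin d => -(B : ℤ)) (fun _ => (B : ℤ))).subset fun z hz => ?_
  have habs : ∀ j, |(z j : ℝ)| ≤ B := fun j =>
    (norm_le_pi_norm (fun j => (z j : ℝ)) j).trans ((hR _ hz).trans hB)
  exact ⟨fun j => by exact_mod_cast (abs_le.mp (habs j)).1,
    fun j => by exact_mod_cast (abs_le.mp (habs j)).2⟩

lemma one_le_lcmDenominators {d : ℕ} (V : Finset (Fin d → ℚ)) : 1 ≤ lcmDenominators V := by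
  refine Nat.one_le_iff_ne_zero.mpr fun h => ?_
  obtain ⟨v, -, hv⟩ := Finset.lcm_eq_zero_iff.mp h
  obtain ⟨j, -, hj⟩ := Finset.lcm_eq_zero_iff.mp hv
  exact (v j).den_nz hj

lemma exists_lcmDenominators_mul_eq {d : ℕ} {V : Finset (Fin d → ℚ)} {v : Fin d → ℚ}
    (hv : v ∈ V) (j : Fin d) : ∃ z : ℤ, (lcmDenominators V : ℝ) * (v j : ℝ) = z := by
  obtain ⟨t, ht⟩ : (v j).den ∣ lcmDenominators V :=
    (Finset.dvd_lcm (f := fun j => (v j).den) (Finset.mem_univ j)).trans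
      (Finset.dvd_lcm (f := fun v : Fin d → ℚ => Finset.univ.lcm fun j => (v j).den) hv)
  refine ⟨t * (v j).num, ?_⟩
  have h : ((v j).den : ℚ) * v j = (v j).num := Rat.den_mul_eq_num (v j)
  have h' : ((v j).den : ℝ) * (v j : ℝ) = (v j).num := by exact_mod_cast h
  rw [ht]
  push_cast
  rw [← h']
  ring

/-- A half-open polyhedron with bounded closed counterpart is a union of open faces of the
triangulation of the latter. -/
lemma hasQuasiPeriod_ehr_halfOpen {m d : ℕ} (A : Matrix (Fin m) (Fin d) ℤ) (b : Fin m → ℤ)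
    (S : Set (Fin m)) (V : Finset (Fin d → ℚ))
    (hV : convexHull ℝ ((fun (v : Fin d → ℚ) (j : Fin d) => (v j : ℝ)) ''
      (V : Set (Fin d → ℚ))) = {x : Fin d → ℝ | ∀ i, (b i : ℝ) ≤ ∑ j, (A i j : ℝ) * x j}) :
    HasQuasiPeriod (ehr {x : Fin d → ℝ | (∀ i ∉ S, (b i : ℝ) ≤ ∑ j, (A i j : ℝ) * x j) ∧
      (∀ i ∈ S, (b i : ℝ) < ∑ j, (A i j : ℝ) * x j)}) (lcmDenominators V) := by
  set v : Fin V.card → Fin d → ℝ := fun i j => ((V.equivFin.symm i : Fin d → ℚ) j : ℝ) with hvdef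
  have hrange : Set.range v =
      (fun (v : Fin d → ℚ) (j : Fin d) => (v j : ℝ)) '' (V : Set (Fin d → ℚ)) := by
    ext x
    constructor
    · rintro ⟨i, rfl⟩
      exact ⟨_, (V.equivFin.symm i).2, rfl⟩
    · rintro ⟨w, hw, rfl⟩
      exact ⟨V.equivFin ⟨w, hw⟩, by simp [hvdef]⟩
  rw [← hrange] at hV
  have hvP : ∀ l i, (b i : ℝ) ≤ ∑ j, (A i j : ℝ) * v l j := fun l =>
    hV.subset (subset_convexHull ℝ _ ⟨l, rfl⟩)
  -- These faces have their relative interior in the half-open polyhedron: all vertices satisfy the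
  -- weak inequalities, so a combination with positive weights on `W` is strict exactly when some
  -- vertex of `W` is.
  set G : Set (Set (Fin V.card)) := {W | W.Nonempty ∧ IsLexFace v W ∧
    ∀ i ∈ S, ∃ l ∈ W, (b i : ℝ) < ∑ j, (A i j : ℝ) * v l j} with hGdef
  have hφ : ∀ (c : Fin V.card → ℝ) (i : Fin m), ∑ j, (A i j : ℝ) * (∑ l, c l • v l) j =
      ∑ l, c l * ∑ j, (A i j : ℝ) * v l j := by
    intro c i
    simp only [Finset.sum_apply, Pi.smul_apply, smul_eq_mul, Finset.mul_sum]
    rw [Finset.sum_comm]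
    exact Finset.sum_congr rfl fun l _ => Finset.sum_congr rfl fun j _ => by ring
  refine (hasQuasiPeriod_ncard_latticeCoeffs (one_le_lcmDenominators V) v
    (fun l j => exists_lcmDenominators_mul_eq (V.equivFin.symm l).2 j) (G := G)
    (fun W hW => hW.2.1) (fun W hW => hW.1)).congr fun k hk => ?_
  have hk0 : (0 : ℝ) < k := by exact_mod_cast hk
  symm
  -- The bijection sends a coefficient vector to its lattice point; scaling the weights by 1/k or k
  -- passes between kX and X.
  refine Set.ncard_congr (fun c hc => hc.2.2.2.choose) ?_ ?_ ?_
  · intro c hc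
    have hz := hc.2.2.2.choose_spec
    have hc0 := hc.1
    have hck := hc.2.1
    have hS := hc.2.2.1.2.2
    have hsum : ∑ l, (k : ℝ)⁻¹ * c l = 1 := by
      rw [← Finset.mul_sum, hck, inv_mul_cancel₀ hk0.ne']
    have hnn : ∀ l, 0 ≤ (k : ℝ)⁻¹ * c l := fun l => mul_nonneg (by positivity) (hc0 l)
    have hle : ∀ i l, ((k : ℝ)⁻¹ * c l) * b i ≤
        ((k : ℝ)⁻¹ * c l) * ∑ j, (A i j : ℝ) * v l j := fun i l =>
      mul_le_mul_of_nonneg_left (hvP l i) (hnn l)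
    refine ⟨∑ l, ((k : ℝ)⁻¹ * c l) • v l, ⟨fun i _ => ?_, fun i hi => ?_⟩, ?_⟩
    · rw [hφ, ← one_mul (b i : ℝ), ← hsum, Finset.sum_mul]
      exact Finset.sum_le_sum fun l _ => hle i l
    · rw [hφ, ← one_mul (b i : ℝ), ← hsum, Finset.sum_mul]
      obtain ⟨l, hl, hlt⟩ := hS i hi
      refine Finset.sum_lt_sum (fun l _ => hle i l) ⟨l, Finset.mem_univ l, ?_⟩
      refine mul_lt_mul_of_pos_left hlt (mul_pos (by positivity) ?_)
      exact lt_of_le_of_ne (hc0 l) (Ne.symm hl)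
    · rw [← hz]
      simp only [mul_smul, ← Finset.smul_sum]
      exact smul_inv_smul₀ hk0.ne' _
  · intro c c' hc hc' h
    refine hc.2.2.1.2.1.coeff_unique hc'.2.2.1.2.1 hc.1 hc'.1 (hc.2.1.trans hc'.2.1.symm) ?_
    rw [hc.2.2.2.choose_spec, hc'.2.2.2.choose_spec]
    exact congrArg (fun (z : Fin d → ℤ) (j : Fin d) => (z j : ℝ)) h
  · rintro z ⟨x, ⟨hx1, hx2⟩, hxz⟩
    have hxP : x ∈ convexHull ℝ (Set.range v) := by
      rw [hV]
      intro i
      by_cases hi : i ∈ S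
      · exact (hx2 i hi).le
      · exact hx1 i hi
    obtain ⟨c, hc0, hc1, hcx, hface⟩ := exists_coeff_isLexFace v hxP
    have hsupp : Function.support ((k : ℝ) • c) = Function.support c := by
      ext l
      simp [hk0.ne']
    have hkpt : ∑ l, ((k : ℝ) • c) l • v l = fun j => (z j : ℝ) := by
      simp only [Pi.smul_apply, smul_eq_mul, mul_smul, ← Finset.smul_sum, hcx]
      exact hxz
    have hmem : (k : ℝ) • c ∈ latticeCoeffs v G k := by
      refine ⟨fun l => mul_nonneg hk0.le (hc0 l), ?_, ?_, z, hkpt⟩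
      · simp [← Finset.mul_sum, hc1]
      · rw [hsupp]
        refine ⟨?_, hface, fun i hi => ?_⟩
        · rw [Function.support_nonempty_iff]
          rintro rfl
          simp at hc1
        · by_contra hcon
          push Not at hcon
          have h1 := hx2 i hi
          rw [← hcx, hφ] at h1
          refine absurd h1 (not_lt.mpr ?_)
          rw [← one_mul (b i : ℝ), ← hc1, Finset.sum_mul]
          refine Finset.sum_le_sum fun l _ => ?_
          by_cases hl : c l = 0
          · simp [hl]
          · exact mul_le_mul_of_nonneg_left (hcon l hl) (hc0 l)
    refine ⟨(k : ℝ) • c, hmem, ?_⟩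
    have := hmem.2.2.2.choose_spec.symm.trans hkpt
    funext j
    exact_mod_cast congrFun this j

/-- The closed counterpart of a nonempty bounded half-open polyhedron is bounded. -/
lemma isBounded_of_halfOpen {m d : ℕ} {A : Matrix (Fin m) (Fin d) ℤ} {b : Fin m → ℤ}
    {S : Set (Fin m)}
    (hne : {x : Fin d → ℝ | (∀ i ∉ S, (b i : ℝ) ≤ ∑ j, (A i j : ℝ) * x j) ∧
      (∀ i ∈ S, (b i : ℝ) < ∑ j, (A i j : ℝ) * x j)}.Nonempty)
    (hbd : Bornology.IsBounded {x : Fin d → ℝ |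
      (∀ i ∉ S, (b i : ℝ) ≤ ∑ j, (A i j : ℝ) * x j) ∧
      (∀ i ∈ S, (b i : ℝ) < ∑ j, (A i j : ℝ) * x j)}) :
    Bornology.IsBounded {x : Fin d → ℝ | ∀ i, (b i : ℝ) ≤ ∑ j, (A i j : ℝ) * x j} := by
  obtain ⟨y, hy1, hy2⟩ := hne
  obtain ⟨R, hR⟩ := hbd.exists_norm_le
  refine isBounded_iff_forall_norm_le.mpr ⟨2 * R + ‖y‖, fun x hx => ?_⟩
  have e : ∀ i, ∑ j, (A i j : ℝ) * ((2 : ℝ)⁻¹ • (x + y)) j =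
      2⁻¹ * (∑ j, (A i j : ℝ) * x j + ∑ j, (A i j : ℝ) * y j) := by
    intro i
    rw [← Finset.sum_add_distrib, Finset.mul_sum]
    refine Finset.sum_congr rfl fun j _ => ?_
    simp only [Pi.add_apply, Pi.smul_apply, smul_eq_mul]
    ring
  have h := hR ((2 : ℝ)⁻¹ • (x + y)) ⟨fun i hi => by rw [e]; linarith [hx i, hy1 i hi],
    fun i hi => by rw [e]; linarith [hx i, hy2 i hi]⟩
  rw [norm_smul, norm_inv, Real.norm_ofNat] at h
  have hxy : ‖x‖ ≤ ‖x + y‖ + ‖y‖ := by simpa using norm_sub_le (x + y) y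
  linarith

/-- The empty set is treated apart, since its defining inequalities, once made weak, may describe an
unbounded set. -/
lemma IsHalfOpenPolytope.exists_hasQuasiPeriod {d : ℕ} {Q : Set (Fin d → ℝ)}
    (hQ : IsHalfOpenPolytope Q) : ∃ ℓ, 1 ≤ ℓ ∧ HasQuasiPeriod (ehr Q) ℓ := by
  obtain ⟨⟨m, A, b, S, rfl⟩, hbd⟩ := hQ
  rcases Set.eq_empty_or_nonempty {x : Fin d → ℝ |
      (∀ i ∉ S, (b i : ℝ) ≤ ∑ j, (A i j : ℝ) * x j) ∧
      (∀ i ∈ S, (b i : ℝ) < ∑ j, (A i j : ℝ) * x j)} with he | hne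
  · refine ⟨1, le_rfl, (HasQuasiPeriod.zero le_rfl).congr fun k _ => ?_⟩
    rw [he]
    simp [ehr, latticePoints]
  · obtain ⟨V, -, hV⟩ := exists_vertices A b (isBounded_of_halfOpen hne hbd)
    exact ⟨_, one_le_lcmDenominators V, hasQuasiPeriod_ehr_halfOpen A b S V hV⟩

/-- As k ≠ 0, dilation by k is injective and keeps the pieces disjoint. -/
lemma ehr_iUnion {d n : ℕ} {Q : Fin n → Set (Fin d → ℝ)}
    (hQ : ∀ i, Bornology.IsBounded (Q i)) (hdisj : Pairwise fun i j => Disjoint (Q i) (Q j))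
    {k : ℕ} (hk : 1 ≤ k) : ehr (⋃ i, Q i) k = ∑ i, ehr (Q i) k := by
  classical
  have hk0 : (k : ℝ) ≠ 0 := by positivity
  have hfin : ∀ i, (latticePoints (Q i) k).Finite := fun i => finite_latticePoints (hQ i) k
  have hU : latticePoints (⋃ i, Q i) k =
      ((Finset.univ.biUnion fun i => (hfin i).toFinset : Finset (Fin d → ℤ)) :
        Set (Fin d → ℤ)) := by
    ext z
    simp [latticePoints, Set.mem_smul_set_iff_inv_smul_mem₀ hk0]
  rw [ehr, hU, Set.ncard_coe_finset, Finset.card_biUnion]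
  · exact Finset.sum_congr rfl fun i _ => (Set.ncard_eq_toFinset_card _ (hfin i)).symm
  · intro i _ j _ hij
    rw [Function.onFun, Finset.disjoint_left]
    intro z hz hz'
    simp only [Set.Finite.mem_toFinset, latticePoints, Set.mem_ofPred_eq,
      Set.mem_smul_set_iff_inv_smul_mem₀ hk0] at hz hz'
    exact Set.disjoint_left.mp (hdisj hij) hz hz'

lemma IsPartialPolytopalComplex.exists_hasQuasiPeriod {d : ℕ} {X : Set (Fin d → ℝ)}
    (hX : IsPartialPolytopalComplex X) : ∃ ℓ, HasQuasiPeriod (ehr X) ℓ := by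
  obtain ⟨n, Q, hQ, hdisj, rfl⟩ := hX
  choose ℓ hℓ hper using fun i => (hQ i).exists_hasQuasiPeriod
  have hL : 1 ≤ ∏ i, ℓ i := Finset.one_le_prod' fun i _ => hℓ i
  exact ⟨∏ i, ℓ i, (HasQuasiPeriod.sum hL Finset.univ fun i _ =>
    (hper i).of_dvd hL (Finset.dvd_prod_of_mem ℓ (Finset.mem_univ i))).congr
      fun k hk => ehr_iUnion (fun i => (hQ i).2) hdisj hk⟩

lemma IsPartialPolytopalComplex.isBounded {d : ℕ} {X : Set (Fin d → ℝ)}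
    (hX : IsPartialPolytopalComplex X) : Bornology.IsBounded X := by
  obtain ⟨n, Q, hQ, -, rfl⟩ := hX
  exact Bornology.isBounded_iUnion.mpr fun i => (hQ i).2

end EhrhartTheory

theorem mainTheorem1 (d : ℕ) :
    (∀ X : Set (Fin d → ℝ), EhrhartTheory.IsPartialPolytopalComplex X →
      (∀ k : ℕ, 1 ≤ k → (EhrhartTheory.latticePoints X k).Finite) ∧
      ∃ q : ℤ → ℚ, EhrhartTheory.IsQuasipolynomial q ∧
        EhrhartTheory.AgreesOnPositive (EhrhartTheory.ehr X) q) ∧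
    (∀ P : Set (Fin d → ℝ), EhrhartTheory.IsPolytope P →
      -- `V` is the set of vertices of `P`, which are finitely many rational points
      ∃ V : Finset (Fin d → ℚ),
        (fun (v : Fin d → ℚ) (j : Fin d) => (v j : ℝ)) '' (V : Set (Fin d → ℚ)) =
          Set.extremePoints ℝ P ∧
        ∃ q : ℤ → ℚ,
          EhrhartTheory.IsQuasipolynomialWithPeriod q (EhrhartTheory.lcmDenominators V) ∧
          EhrhartTheory.AgreesOnPositive (EhrhartTheory.ehr P) q) := by

  refine ⟨fun X hX => ⟨fun k _ => EhrhartTheory.finite_latticePoints hX.isBounded k, ?_⟩, ?_⟩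
  · obtain ⟨ℓ, q, hq, hXq⟩ := hX.exists_hasQuasiPeriod
    exact ⟨q, ⟨ℓ, hq⟩, hXq⟩
  · rintro P ⟨⟨m, A, b, rfl⟩, hbd⟩
    obtain ⟨V, hV, hconv⟩ := EhrhartTheory.exists_vertices A b hbd
    refine ⟨V, hV, ?_⟩
    -- With no strict inequality, the half-open polyhedron is the polytope itself.
    have h := EhrhartTheory.hasQuasiPeriod_ehr_halfOpen A b ∅ V hconv
    simp only [Set.mem_empty_iff_false, not_false_eq_true, forall_true_left, false_implies,
      implies_true, and_true] at h
    exact h
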